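/- Let $M$ be a closed manifold (compact, connected, Hausdorff, without boundary) and let $\mathcal F$ be a continuous codimension-one foliation of $M$ with Riemannian leaves of dimension $n$. That is, $M$ is covered by charts with values in $\mathbb R^n\times\mathbb R$ whose changes of coordinates have locally the form $(x,y)\mapsto(a(x,y),h(y))$, where $a$ is of class $C^2$ in $x$ and its derivatives in $x$ of order at most $2$ are continuous in $(x,y)$; and the leaves carry Riemannian metrics whose coefficients in these charts are of class $C^1$ in $x$, the coefficients and their first derivatives in $x$ being continuous in $(x,y)$. (This covers in particular $C^r$ leaves and $C^r$ leafwise metrics, $2\le r\le\infty$, varying continuously on $M$.) A function $f:M\to\mathbb R$ is called leafwise harmonic if it is continuous on $M$ and its restriction to every leaf is of class $C^2$ and is annihilated by the Laplace–Beltrami operator of the leaf. Suppose that $\mathcal F$ is $\mathbb R$-covered, that is, the space of leaves $\widetilde M/\widetilde{\mathcal F}$ of the lift $\widetilde{\mathcal F}$ of $\mathcal F$ to the universal cover $\widetilde M$ of $M$, with the quotient topology, is homeomorphic to $\mathbb R$; and suppose that no leaf of $\mathcal F$ is compact. Then every leafwise harmonic function is constant on $M$. In particular $(M,\mathcal F)$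 has the Liouville property: every leafwise harmonic function is constant on each leaf. -/

import Mathlib

open scoped Topology

universe u

/-- The model space `ℝⁿ` of the leaves. -/
abbrev LeafModel (n : ℕ) : Type := EuclideanSpace ℝ (Fin n)

/-- `f(x, y)` is of class `C^k` in the leaf variable `x` on the (open) set `U`, and its derivatives
in `x` of order at most `k` are continuous in `(x, y)`. -/
def LeafwiseContDiffOn {n : ℕ} {W : Type*} [NormedAddCommGroup W] [NormedSpace ℝ W]
    (k : ℕ) (f : LeafModel n × ℝ → W) (U : Set (LeafModel n × ℝ)) : Prop :=
  (∀ q ∈ U, ContDiffAt ℝ k (fun x => f (x, q.2)) q.1) ∧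
    ∀ j ≤ k, ContinuousOn (fun q => iteratedFDeriv ℝ j (fun x => f (x, q.2)) q.1) U

theorem LeafwiseContDiffOn.congr_mono {n : ℕ} {W : Type*} [NormedAddCommGroup W]
    [NormedSpace ℝ W] {k : ℕ} {f g : LeafModel n × ℝ → W} {U U' : Set (LeafModel n × ℝ)}
    (hf : LeafwiseContDiffOn k f U) (hU' : IsOpen U') (hsub : U' ⊆ U) (hfg : Set.EqOn g f U') :
    LeafwiseContDiffOn k g U' := by
  have key : ∀ q ∈ U', (fun x => g (x, q.2)) =ᶠ[𝓝 q.1] (fun x => f (x, q.2)) := by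
    intro q hq
    have hc : ContinuousAt (fun x : LeafModel n => (x, q.2)) q.1 := by fun_prop
    filter_upwards [hc.preimage_mem_nhds (hU'.mem_nhds hq)] with x hx
    exact hfg hx
  refine ⟨fun q hq => (hf.1 q (hsub hq)).congr_of_eventuallyEq (key q hq), fun j hj => ?_⟩
  refine ((hf.2 j hj).mono hsub).congr fun q hq => ?_
  exact ((key q hq).iteratedFDeriv ℝ j).eq_of_nhds

/-- A continuous codimension-one foliation of `M` (without boundary) with leaves of dimension `n`
and of class `C²`, given by a foliated atlas: charts with values in `ℝⁿ × ℝ` whose changes of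
coordinates are locally of the form `(x, y) ↦ (a(x, y), h(y))`, with `a` of class `C²` in `x` and
its derivatives in `x` of order at most two continuous in `(x, y)`. -/
structure CodimOneFoliation (n : ℕ) (M : Type u) [TopologicalSpace M] where
  atlas : Set (OpenPartialHomeomorph M (LeafModel n × ℝ))
  covers : ∀ x : M, ∃ φ ∈ atlas, x ∈ φ.source
  transverse : ∀ φ ∈ atlas, ∀ ψ ∈ atlas, ∀ p ∈ (φ.symm.trans ψ).source,
    ∃ h : ℝ → ℝ, ∀ᶠ q in 𝓝 p, (φ.symm.trans ψ q).2 = h q.2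
  leafwise : ∀ φ ∈ atlas, ∀ ψ ∈ atlas,
    LeafwiseContDiffOn 2 (fun q => (φ.symm.trans ψ q).1) (φ.symm.trans ψ).source

namespace CodimOneFoliation

variable {n : ℕ} {M : Type u} [TopologicalSpace M]

/-- The leaf topology: it is generated by the open subsets of the plaques. -/
@[reducible]
def leafTopology (F : CodimOneFoliation n M) : TopologicalSpace M :=
  TopologicalSpace.generateFrom
    {P | ∃ φ ∈ F.atlas, ∃ W : Set (LeafModel n), IsOpen W ∧ ∃ y : ℝ,
      P = {x | x ∈ φ.source ∧ (φ x).1 ∈ W ∧ (φ x).2 = y}}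

/-- Two points are equivalent if they lie on the same leaf; the leaves are the connected
components of `M` in the leaf topology. -/
def leafSetoid (F : CodimOneFoliation n M) : Setoid M :=
  @connectedComponentSetoid M F.leafTopology

/-- The leaf through `x`. -/
def leaf (F : CodimOneFoliation n M) (x : M) : Set M :=
  @connectedComponent M F.leafTopology x

/-- The leaf through `x` is compact, as a manifold (that is, in the leaf topology). -/
def IsCompactLeaf (F : CodimOneFoliation n M) (x : M) : Prop :=
  @IsCompact M F.leafTopology (F.leaf x)

/-- The space of leaves, with the quotient of the topology of `M`. -/
abbrev LeafSpace (F : CodimOneFoliation n M) : Type u := Quotient F.leafSetoid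

/-- The lift of a foliation along a local homeomorphism `p`: its charts are the `φ ∘ p`, on the
open sets on which this is a chart, with `φ` a chart of the given foliation. -/
def lift {E : Type u} [TopologicalSpace E] (F : CodimOneFoliation n M) (p : E → M)
    (hp : IsLocalHomeomorph p) : CodimOneFoliation n E where
  atlas := {χ | ∃ φ ∈ F.atlas, Set.MapsTo p χ.source φ.source ∧ Set.EqOn χ (φ ∘ p) χ.source}
  covers := by
    intro x
    obtain ⟨e, hxe, he⟩ := hp x
    obtain ⟨φ, hφ, hx⟩ := F.covers (p x)
    subst he
    refine ⟨e.trans φ, ⟨φ, hφ, ?_, ?_⟩, ?_⟩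
    · intro z hz
      simp only [OpenPartialHomeomorph.trans_source] at hz
      exact hz.2
    · intro z _
      rfl
    · simp only [OpenPartialHomeomorph.trans_source]
      exact ⟨hxe, hx⟩
  transverse := by
    rintro χ ⟨φ, hφ, hχφ, hχ⟩ ω ⟨ψ, hψ, hωψ, hω⟩ a ha
    have key : ∀ q ∈ (χ.symm.trans ω).source,
        q ∈ (φ.symm.trans ψ).source ∧ χ.symm.trans ω q = φ.symm.trans ψ q := by
      intro q hq
      simp only [OpenPartialHomeomorph.trans_source, OpenPartialHomeomorph.symm_source,
        Set.mem_inter_iff, Set.mem_preimage] at hq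
      have hz := χ.map_target hq.1
      have h1 : φ (p (χ.symm q)) = q := by
        rw [← χ.right_inv hq.1, χ.left_inv hz]; exact (hχ hz).symm
      have h2 : φ.symm q = p (χ.symm q) := by
        rw [← φ.left_inv (hχφ hz), h1]
      refine ⟨?_, ?_⟩
      · simp only [OpenPartialHomeomorph.trans_source, OpenPartialHomeomorph.symm_source,
          Set.mem_inter_iff, Set.mem_preimage, h2]
        exact ⟨h1 ▸ φ.map_source (hχφ hz), hωψ hq.2⟩
      · simp only [OpenPartialHomeomorph.coe_trans, Function.comp_apply, h2]
        exact hω hq.2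
    obtain ⟨h, hh⟩ := F.transverse φ hφ ψ hψ a (key a ha).1
    refine ⟨h, ?_⟩
    filter_upwards [hh, (χ.symm.trans ω).open_source.mem_nhds ha] with q hq hq'
    rw [(key q hq').2, hq]
  leafwise := by
    rintro χ ⟨φ, hφ, hχφ, hχ⟩ ω ⟨ψ, hψ, hωψ, hω⟩
    have key : ∀ q ∈ (χ.symm.trans ω).source,
        q ∈ (φ.symm.trans ψ).source ∧ χ.symm.trans ω q = φ.symm.trans ψ q := by
      intro q hq
      simp only [OpenPartialHomeomorph.trans_source, OpenPartialHomeomorph.symm_source,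
        Set.mem_inter_iff, Set.mem_preimage] at hq
      have hz := χ.map_target hq.1
      have h1 : φ (p (χ.symm q)) = q := by
        rw [← χ.right_inv hq.1, χ.left_inv hz]; exact (hχ hz).symm
      have h2 : φ.symm q = p (χ.symm q) := by
        rw [← φ.left_inv (hχφ hz), h1]
      refine ⟨?_, ?_⟩
      · simp only [OpenPartialHomeomorph.trans_source, OpenPartialHomeomorph.symm_source,
          Set.mem_inter_iff, Set.mem_preimage, h2]
        exact ⟨h1 ▸ φ.map_source (hχφ hz), hωψ hq.2⟩
      · simp only [OpenPartialHomeomorph.coe_trans, Function.comp_apply, h2]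
        exact hω hq.2
    exact (F.leafwise φ hφ ψ hψ).congr_mono (χ.symm.trans ω).open_source
      (fun q hq => (key q hq).1) (fun q hq => congrArg Prod.fst (key q hq).2)

/-- `F` is `ℝ`-covered: the space of leaves of the lift of `F` to the universal cover of `M` is
homeomorphic to `ℝ`. The universal cover is a simply connected covering space of `M`; it is unique
up to isomorphism. -/
def IsRCovered (F : CodimOneFoliation n M) : Prop :=
  ∃ (E : Type u) (_ : TopologicalSpace E) (_ : SimplyConnectedSpace E) (p : E → M)
    (hp : IsCoveringMap p), Nonempty ((F.lift p hp.isLocalHomeomorph).LeafSpace ≃ₜ ℝ)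

end CodimOneFoliation

noncomputable section

/-- The partial derivative `∂ᵢ u` at `x`. -/
def leafPartial {n : ℕ} (i : Fin n) (u : LeafModel n → ℝ) (x : LeafModel n) : ℝ :=
  fderiv ℝ u x (EuclideanSpace.single i 1)

/-- The Christoffel symbol `Γᵏᵢⱼ` at `x` of the metric `G`. -/
def christoffelSymbol {n : ℕ} (G : LeafModel n → Matrix (Fin n) (Fin n) ℝ) (x : LeafModel n)
    (k i j : Fin n) : ℝ :=
  (1 / 2) * ∑ l, (G x)⁻¹ k l *
    (leafPartial i (fun z => G z j l) x + leafPartial j (fun z => G z i l) x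
      - leafPartial l (fun z => G z i j) x)

/-- The Laplace–Beltrami operator of the metric `G` in coordinates, the trace of the covariant
Hessian: `Δu = gⁱʲ (∂ᵢ∂ⱼu - Γᵏᵢⱼ ∂ₖu)`. -/
def laplaceBeltrami {n : ℕ} (G : LeafModel n → Matrix (Fin n) (Fin n) ℝ) (u : LeafModel n → ℝ)
    (x : LeafModel n) : ℝ :=
  ∑ i, ∑ j, (G x)⁻¹ i j *
    (leafPartial i (leafPartial j u) x - ∑ k, christoffelSymbol G x k i j * leafPartial k u x)

/-- The Jacobian matrix at `q`, in the leaf direction, of a change of coordinates `τ`. -/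
def leafJacobian {n : ℕ} (τ : LeafModel n × ℝ → LeafModel n × ℝ) (q : LeafModel n × ℝ) :
    Matrix (Fin n) (Fin n) ℝ :=
  Matrix.of fun k i => leafPartial i (fun x => (τ (x, q.2)).1 k) q.1

/-- A Riemannian metric on the leaves of `F`: positive definite symmetric matrices of coefficients
in each chart, of class `C¹` along the leaves, continuous on `M` together with their first leafwise
derivatives, and transforming as a covariant 2-tensor. -/
structure LeafwiseMetric {n : ℕ} {M : Type u} [TopologicalSpace M]
    (F : CodimOneFoliation n M) where
  coeff : OpenPartialHomeomorph M (LeafModel n × ℝ) → LeafModel n × ℝ → Matrix (Fin n) (Fin n) ℝ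
  posDef : ∀ φ ∈ F.atlas, ∀ q ∈ φ.target, (coeff φ q).PosDef
  regular : ∀ φ ∈ F.atlas, ∀ i j, LeafwiseContDiffOn 1 (fun q => coeff φ q i j) φ.target
  compatible : ∀ φ ∈ F.atlas, ∀ ψ ∈ F.atlas, ∀ q ∈ (φ.symm.trans ψ).source,
    coeff φ q = (leafJacobian (φ.symm.trans ψ) q).transpose * coeff ψ (φ.symm.trans ψ q) *
      leafJacobian (φ.symm.trans ψ) q

end

namespace LeafwiseMetric

variable {n : ℕ} {M : Type u} [TopologicalSpace M] {F : CodimOneFoliation n M}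

/-- `f` is continuous on `M` and, on every leaf, of class `C²` and harmonic. -/
def IsLeafwiseHarmonic (g : LeafwiseMetric F) (f : M → ℝ) : Prop :=
  Continuous f ∧ ∀ φ ∈ F.atlas, ∀ q ∈ φ.target,
    ContDiffAt ℝ 2 (fun x => f (φ.symm (x, q.2))) q.1 ∧
      laplaceBeltrami (fun x => g.coeff φ (x, q.2)) (fun x => f (φ.symm (x, q.2))) q.1 = 0

/-- Every leafwise harmonic function is constant on each leaf. -/
def LiouvilleProperty (g : LeafwiseMetric F) : Prop :=
  ∀ f : M → ℝ, g.IsLeafwiseHarmonic f → ∀ x : M, ∀ y ∈ F.leaf x, f y = f x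

end LeafwiseMetric

/-! Let `f` be a nonconstant leafwise harmonic function, and let `A` and `B` be the closed sets
where it attains its minimum and maximum. By the strong maximum principle on the leaves, both are
saturated, so they come from disjoint closed sets `A'`, `B'` in the leaf space `ℝ` of the lifted
foliation. The endpoints in `A'` of the gaps between `A'` and `B'` form a nonempty closed discrete
subset `D` of `ℝ`, invariant under deck transformations. The leaves over `D` therefore project to a
closed saturated set `K` in `M`. Since `D` is discrete and each leaf crosses a small transversal in
the universal cover at most once, the leaf topology on `K` is the topology induced from `M`. So `K`
is compact in the leaf topology, and its leaves are compact, a contradiction.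

The strong maximum principle rests on Hopf's argument: at a point `z` where `s = 0` and `Ds ≠ 0`,
the function `s - ‖x - z‖² + β s²` is strictly subharmonic near `z` for suitable `β`. Adding a small
multiple of it to a subharmonic function that has a maximum at `z` and is smaller where `s > 0`
would produce an interior maximum of a strictly subharmonic function. -/

section TransitionSet

/-- The points of `A` next to `B`: those joined to a point of `B` by a connected set which meets
`A ∪ B` nowhere else. In an ordered space these are the endpoints in `A` of the gaps between `A` and
`B`; the topological wording makes the notion visibly invariant under continuous maps. -/
def transitionSet {X : Type*} [TopologicalSpace X] (A B : Set X) : Set X :=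
  {a | a ∈ A ∧ ∃ b ∈ B, ∃ S : Set X, IsPreconnected S ∧ a ∈ S ∧ b ∈ S ∧ S ∩ (A ∪ B) ⊆ {a, b}}

theorem transitionSet_subset {X : Type*} [TopologicalSpace X] (A B : Set X) :
    transitionSet A B ⊆ A :=
  fun _ h => h.1

theorem map_mem_transitionSet {X Y : Type*} [TopologicalSpace X] [TopologicalSpace Y]
    {A B : Set Y} {σ : X → Y} (hσ : Continuous σ) {a : X}
    (ha : a ∈ transitionSet (σ ⁻¹' A) (σ ⁻¹' B)) : σ a ∈ transitionSet A B := by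
  obtain ⟨haA, b, hb, S, hS, haS, hbS, hsub⟩ := ha
  refine ⟨haA, σ b, hb, σ '' S, hS.image σ hσ.continuousOn, ⟨a, haS, rfl⟩, ⟨b, hbS, rfl⟩, ?_⟩
  rintro _ ⟨⟨s, hs, rfl⟩, hs'⟩
  exact (hsub ⟨hs, hs'⟩).imp (congrArg σ) (congrArg σ)

variable {α : Type*} [ConditionallyCompleteLinearOrder α] [TopologicalSpace α] [OrderTopology α]
  {A B : Set α}

theorem exists_Icc_inter_union_subset_pair (hA : IsClosed A) (hB : IsClosed B) {a₀ b₀ : α}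
    (ha₀ : a₀ ∈ A) (hb₀ : b₀ ∈ B) (h : a₀ ≤ b₀) :
    ∃ a ∈ A, ∃ b ∈ B, a ≤ b ∧ Set.Icc a b ∩ (A ∪ B) ⊆ {a, b} := by
  obtain ⟨a, ⟨haA, ha⟩, hamax⟩ := (isCompact_Icc.inter_left hA).exists_isGreatest
    ⟨a₀, ha₀, Set.left_mem_Icc.2 h⟩
  obtain ⟨b, ⟨hbB, hb⟩, hbmin⟩ := (isCompact_Icc.inter_left hB).exists_isLeast
    ⟨b₀, hb₀, Set.right_mem_Icc.2 ha.2⟩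
  refine ⟨a, haA, b, hbB, hb.1, ?_⟩
  rintro x ⟨hx, hxA | hxB⟩
  · exact Or.inl (le_antisymm (hamax ⟨hxA, ha.1.trans hx.1, hx.2.trans hb.2⟩) hx.1)
  · exact Or.inr (le_antisymm hx.2 (hbmin ⟨hxB, hx.1, hx.2.trans hb.2⟩))

theorem transitionSet_nonempty [DenselyOrdered α] (hA : IsClosed A) (hB : IsClosed B)
    (hA' : A.Nonempty) (hB' : B.Nonempty) : (transitionSet A B).Nonempty := by
  obtain ⟨a₀, ha₀⟩ := hA'
  obtain ⟨b₀, hb₀⟩ := hB'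
  rcases le_total a₀ b₀ with h | h
  · obtain ⟨a, ha, b, hb, hab, hsub⟩ := exists_Icc_inter_union_subset_pair hA hB ha₀ hb₀ h
    exact ⟨a, ha, b, hb, Set.Icc a b, isPreconnected_Icc, Set.left_mem_Icc.2 hab,
      Set.right_mem_Icc.2 hab, hsub⟩
  · obtain ⟨b, hb, a, ha, hab, hsub⟩ := exists_Icc_inter_union_subset_pair hB hA hb₀ ha₀ h
    refine ⟨a, ha, b, hb, Set.Icc b a, isPreconnected_Icc, Set.right_mem_Icc.2 hab,
      Set.left_mem_Icc.2 hab, ?_⟩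
    rwa [Set.union_comm, Set.pair_comm]

end TransitionSet

section OrderTopology

variable {α : Type*} [LinearOrder α] [TopologicalSpace α] [OrderTopology α] {A B N : Set α}

theorem isGreatest_or_isLeast_of_mem_transitionSet (hAB : Disjoint A B) (hN : N.OrdConnected)
    (hNB : Disjoint N B) {a : α} (ha : a ∈ transitionSet A B) (haN : a ∈ N) :
    IsGreatest (A ∩ N) a ∨ IsLeast (A ∩ N) a := by
  obtain ⟨haA, b, hb, S, hS, haS, hbS, hsub⟩ := ha
  have eq_of_mem_uIcc : ∀ x ∈ A, x ∈ Set.uIcc a b → x = a := fun x hxA hx =>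
    (hsub ⟨hS.ordConnected.uIcc_subset haS hbS hx, Or.inl hxA⟩).resolve_right
      (hAB.ne_of_mem hxA hb)
  have not_mem_Icc {x y : α} (hx : x ∈ N) (hy : y ∈ N) : b ∉ Set.Icc x y :=
    fun h => hNB.notMem_of_mem_left (hN.out hx hy h) hb
  rcases le_total a b with hab | hba
  · refine Or.inl ⟨⟨haA, haN⟩, fun x ⟨hxA, hxN⟩ => ?_⟩
    by_contra! hax
    have hxb : x ≤ b := le_of_not_ge fun hbx => not_mem_Icc haN hxN ⟨hab, hbx⟩
    exact hax.ne' (eq_of_mem_uIcc x hxA (Set.mem_uIcc_of_le hax.le hxb))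
  · refine Or.inr ⟨⟨haA, haN⟩, fun x ⟨hxA, hxN⟩ => ?_⟩
    by_contra! hxa
    have hbx : b ≤ x := le_of_not_ge fun hxb => not_mem_Icc hxN haN ⟨hxb, hba⟩
    exact hxa.ne (eq_of_mem_uIcc x hxA (Set.mem_uIcc_of_ge hbx hxa.le))

theorem finite_transitionSet_inter (hAB : Disjoint A B) (hN : N.OrdConnected)
    (hNB : Disjoint N B) : (transitionSet A B ∩ N).Finite := by
  have hgreatest : {a | IsGreatest (A ∩ N) a}.Subsingleton := fun _ h _ h' => h.unique h'
  have hleast : {a | IsLeast (A ∩ N) a}.Subsingleton := fun _ h _ h' => h.unique h'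
  exact (hgreatest.finite.union hleast.finite).subset fun _ ha =>
    isGreatest_or_isLeast_of_mem_transitionSet hAB hN hNB ha.1 ha.2

theorem isClosed_and_isDiscrete_transitionSet (hA : IsClosed A) (hB : IsClosed B)
    (hAB : Disjoint A B) : IsClosed (transitionSet A B) ∧ IsDiscrete (transitionSet A B) := by
  refine isClosed_and_discrete_iff.2 fun x => Filter.disjoint_principal_right.2 ?_
  by_cases hx : x ∈ B
  · have hxA : Aᶜ ∈ 𝓝 x := hA.isOpen_compl.mem_nhds (hAB.notMem_of_mem_right hx)
    exact mem_nhdsWithin_of_mem_nhds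
      (Filter.mem_of_superset hxA (Set.compl_subset_compl.2 (transitionSet_subset A B)))
  · have hNx : Bᶜ.ordConnectedComponent x ∈ 𝓝 x :=
      Set.ordConnectedComponent_mem_nhds.2 (hB.isOpen_compl.mem_nhds hx)
    have hfin := finite_transitionSet_inter hAB inferInstance
      (Set.subset_compl_iff_disjoint_right.1 (Set.ordConnectedComponent_subset (s := Bᶜ) (x := x)))
    filter_upwards [mem_nhdsWithin_of_mem_nhds hNx,
      nhdsNE_le_cofinite x hfin.compl_mem_cofinite] with y hyN hy hyD using hy ⟨hyD, hyN⟩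

end OrderTopology

section Injectivity

variable {α β : Type*} [TopologicalSpace α] [LinearOrder β] [TopologicalSpace β] [OrderTopology β]
  [DenselyOrdered β] [NoMinOrder β] [NoMaxOrder β]

theorem not_isLocalExtr_of_nhds_le_map {c : α → β} {x : α} (h : 𝓝 (c x) ≤ Filter.map c (𝓝 x)) :
    ¬ IsLocalExtr c x := by
  rintro (hmin | hmax)
  · have hle : ∀ᶠ z in 𝓝 (c x), c x ≤ z := h hmin
    obtain ⟨z, hz, hz'⟩ := (hle.and_frequently (frequently_lt_nhds (c x))).exists
    exact hz.not_gt hz'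
  · have hle : ∀ᶠ z in 𝓝 (c x), z ≤ c x := h hmax
    obtain ⟨z, hz, hz'⟩ := (hle.and_frequently (frequently_gt_nhds (c x))).exists
    exact hz.not_gt hz'

theorem injOn_of_nhds_le_map [ConditionallyCompleteLinearOrder α] [OrderTopology α]
    [DenselyOrdered α] {c : α → β} {s : Set α} (hs : s.OrdConnected) (hc : ContinuousOn c s)
    (ho : ∀ y ∈ s, 𝓝 (c y) ≤ Filter.map c (𝓝 y)) : Set.InjOn c s := by
  have hne {y z : α} (hy : y ∈ s) (hz : z ∈ s) (hyz : y < z) : c y ≠ c z := fun heq => by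
    obtain ⟨w, hw, hext⟩ := exists_isLocalExtr_Ioo hyz (hc.mono (hs.out hy hz)) heq
    exact not_isLocalExtr_of_nhds_le_map (ho w (hs.out hy hz (Set.Ioo_subset_Icc_self hw))) hext
  intro y hy z hz heq
  by_contra hyz
  exact (lt_or_gt_of_ne hyz).elim (fun h => hne hy hz h heq) fun h => hne hz hy h heq.symm

end Injectivity

theorem surjective_of_isCoveringMap {E X : Type*} [TopologicalSpace E] [TopologicalSpace X]
    [Nonempty E] [ConnectedSpace X] {p : E → X} (hp : IsCoveringMap p) :
    Function.Surjective p := by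
  rw [← Set.range_eq_univ]
  refine IsClopen.eq_univ ⟨isClosed_iff_frequently.2 fun x hx => ?_, hp.isOpenMap.isOpen_range⟩
    (Set.range_nonempty p)
  obtain ⟨-, U, hxU, hU, -, H, -⟩ := hp x
  obtain ⟨_, ⟨z, rfl⟩, hz⟩ := (hx.and_eventually (hU.mem_nhds hxU)).exists
  exact ⟨_, (H ⟨z, hz⟩).2.2⟩

namespace CodimOneFoliation

variable {n : ℕ} {M : Type u} [TopologicalSpace M] {F : CodimOneFoliation n M}
  {φ : OpenPartialHomeomorph M (LeafModel n × ℝ)} {x y : M}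

section LeafTopology

/-- The neighbourhood filter of `x` in the leaf topology. Statements about the leaf topology are
phrased with this filter, since `𝓝 x` refers to the topology of `M`. -/
def leafNhds (F : CodimOneFoliation n M) (x : M) : Filter M :=
  @nhds M F.leafTopology x

theorem leafNhds_eq_map (hφ : φ ∈ F.atlas) (hx : x ∈ φ.source) :
    F.leafNhds x = Filter.map (fun v => φ.symm (v, (φ x).2)) (𝓝 (φ x).1) := by
  refine le_antisymm (fun T hT => ?_) ?_
  · obtain ⟨W, hWT, hW, hxW⟩ := mem_nhds_iff.1 (Filter.mem_map.1 hT)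
    refine (@mem_nhds_iff M F.leafTopology x T).2
      ⟨{z | z ∈ φ.source ∧ (φ z).1 ∈ W ∧ (φ z).2 = (φ x).2}, ?_,
        TopologicalSpace.isOpen_generateFrom_of_mem ⟨φ, hφ, W, hW, (φ x).2, rfl⟩, hx, hxW, rfl⟩
    rintro z ⟨hz, hzW, hzx⟩
    have hzT : φ.symm ((φ z).1, (φ x).2) ∈ T := hWT hzW
    rwa [← hzx, φ.left_inv hz] at hzT
  · refine TopologicalSpace.tendsto_nhds_generateFrom_iff.2 ?_
    rintro _ ⟨ψ, hψ, W, hW, c, rfl⟩ ⟨hxψ, hxW, hxc⟩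
    have hsource : φ x ∈ (φ.symm.trans ψ).source := by
      simpa [φ.left_inv hx, φ.map_source hx] using hxψ
    have hφx : φ.symm.trans ψ (φ x) = ψ x := by simp [φ.left_inv hx]
    obtain ⟨h, hh⟩ := F.transverse φ hφ ψ hψ _ hsource
    have hslice : ContinuousAt (fun v => (v, (φ x).2)) (φ x).1 := by fun_prop
    have hW' : ∀ᶠ q in 𝓝 (φ x), (φ.symm.trans ψ q).1 ∈ W :=
      ((φ.symm.trans ψ).continuousAt hsource).fst.eventually
        (hW.mem_nhds (by simpa only [hφx] using hxW))
    filter_upwards [hslice.eventually hh, hslice.eventually hW',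
      hslice.eventually ((φ.symm.trans ψ).open_source.mem_nhds hsource)] with v hvh hvW hv
    refine ⟨hv.2, hvW, ?_⟩
    rw [← hxc, ← hφx, hh.self_of_nhds]
    exact hvh

theorem leafTopology_le (F : CodimOneFoliation n M) : F.leafTopology ≤ ‹TopologicalSpace M› := by
  refine le_of_nhds_le_nhds fun x => ?_
  obtain ⟨φ, hφ, hx⟩ := F.covers x
  refine (leafNhds_eq_map hφ hx).trans_le ?_
  have hslice : ContinuousAt (fun v => (v, (φ x).2)) (φ x).1 := by fun_prop
  have hcomp := (φ.symm.continuousAt (φ.map_source hx)).tendsto.comp hslice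
  rwa [φ.left_inv hx] at hcomp

theorem nhdsWithin_le_leafNhds (hφ : φ ∈ F.atlas) (hx : x ∈ φ.source) {K : Set M}
    (hK : ∀ᶠ z in 𝓝[K] x, (φ z).2 = (φ x).2) : 𝓝[K] x ≤ F.leafNhds x := by
  have hsection : id =ᶠ[𝓝[K] x] (fun v => φ.symm (v, (φ x).2)) ∘ fun z => (φ z).1 := by
    filter_upwards [hK, mem_nhdsWithin_of_mem_nhds (φ.open_source.mem_nhds hx)] with z hzx hz
    simp [← hzx, φ.left_inv hz]
  have hfst : Filter.Tendsto (fun z => (φ z).1) (𝓝[K] x) (𝓝 (φ x).1) :=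
    (φ.continuousAt hx).fst.mono_left nhdsWithin_le_nhds
  rw [leafNhds_eq_map hφ hx, ← Filter.map_id (f := 𝓝[K] x), Filter.map_congr hsection,
    ← Filter.map_map]
  exact Filter.map_mono hfst

theorem leafSetoid_iff : F.leafSetoid x y ↔ y ∈ F.leaf x :=
  eq_comm.trans (@connectedComponent_eq_iff_mem M F.leafTopology y x)

theorem leafSetoid_of_isPreconnected (hφ : φ ∈ F.atlas) {U : Set (LeafModel n)}
    (hU : IsPreconnected U) {t : ℝ} (hUt : ∀ v ∈ U, (v, t) ∈ φ.target) {v w : LeafModel n}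
    (hv : v ∈ U) (hw : w ∈ U) : F.leafSetoid (φ.symm (v, t)) (φ.symm (w, t)) := by
  have hcont : @ContinuousOn _ M _ F.leafTopology (fun v => φ.symm (v, t)) U := fun v hv => by
    have hnhds := leafNhds_eq_map hφ (φ.map_target (hUt v hv))
    rw [φ.right_inv (hUt v hv)] at hnhds
    exact @ContinuousAt.continuousWithinAt _ M _ F.leafTopology _ _ _ hnhds.ge
  have himage := @IsPreconnected.image _ M _ F.leafTopology U hU _ hcont
  exact leafSetoid_iff.2 (@IsPreconnected.subset_connectedComponent M F.leafTopology _ _ himage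
    ⟨v, hv, rfl⟩ _ ⟨w, hw, rfl⟩)

theorem exists_ball_prod_ball_subset_target (hx : x ∈ φ.source) :
    ∃ ε > 0, Metric.ball (φ x).1 ε ×ˢ Metric.ball (φ x).2 ε ⊆ φ.target := by
  simpa only [ball_prod_same] using
    Metric.mem_nhds_iff.1 (φ.open_target.mem_nhds (φ.map_source hx))

theorem eventually_leafSetoid (F : CodimOneFoliation n M) (x : M) :
    ∀ᶠ y in F.leafNhds x, F.leafSetoid x y := by
  obtain ⟨φ, hφ, hx⟩ := F.covers x
  obtain ⟨ε, hε, hbox⟩ := exists_ball_prod_ball_subset_target hx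
  rw [leafNhds_eq_map hφ hx, Filter.eventually_map]
  filter_upwards [Metric.ball_mem_nhds _ hε] with v hv
  simpa only [φ.left_inv hx] using leafSetoid_of_isPreconnected hφ Metric.isPreconnected_ball
    (fun w hw => hbox ⟨hw, Metric.mem_ball_self hε⟩) (Metric.mem_ball_self hε) hv

end LeafTopology

section Saturated

/-- `A` is saturated: it is a union of leaves of `F`. -/
def IsSaturated (F : CodimOneFoliation n M) (A : Set M) : Prop :=
  ∀ ⦃x y⦄, F.leafSetoid x y → x ∈ A → y ∈ A

theorem IsSaturated.mem_iff {A : Set M} (hA : F.IsSaturated A) (hxy : F.leafSetoid x y) :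
    x ∈ A ↔ y ∈ A :=
  ⟨hA hxy, hA (F.leafSetoid.symm hxy)⟩

theorem isSaturated_iff_isClopen {A : Set M} :
    F.IsSaturated A ↔ @IsClopen M F.leafTopology A := by
  refine ⟨fun hA => ⟨(@isClosed_iff_frequently M F.leafTopology A).2 fun x hx => ?_,
    (@isOpen_iff_eventually M F.leafTopology A).2 fun x hx => ?_⟩, fun hA x y hxy hx => ?_⟩
  · obtain ⟨y, hy, hxy⟩ := (hx.and_eventually (F.eventually_leafSetoid x)).exists
    exact (hA.mem_iff hxy).2 hy
  · exact (F.eventually_leafSetoid x).mono fun y hxy => hA hxy hx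
  · exact @IsClopen.connectedComponent_subset M F.leafTopology _ _ hA hx _ (leafSetoid_iff.1 hxy)

theorem isSaturated_of_eventually_mem {A : Set M} (hA : IsClosed A)
    (h : ∀ x ∈ A, ∀ᶠ y in F.leafNhds x, y ∈ A) : F.IsSaturated A :=
  isSaturated_iff_isClopen.2
    ⟨hA.mono F.leafTopology_le, (@isOpen_iff_eventually M F.leafTopology A).2 h⟩

theorem IsSaturated.isCompactLeaf {K : Set M} (hK : F.IsSaturated K)
    (hcompact : @IsCompact M F.leafTopology K) (hx : x ∈ K) : F.IsCompactLeaf x :=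
  @IsCompact.of_isClosed_subset M F.leafTopology _ _ hcompact
    (@isClosed_connectedComponent M F.leafTopology x) fun _ hy => hK (leafSetoid_iff.2 hy) hx

theorem IsSaturated.symm_mem_interior {S : Set M} (hS : F.IsSaturated S) (hφ : φ ∈ F.atlas)
    {U : Set (LeafModel n)} {V : Set ℝ} (hU : IsOpen U) (hU' : IsPreconnected U) (hV : IsOpen V)
    (hbox : U ×ˢ V ⊆ φ.target) {v w : LeafModel n} {t : ℝ} (hv : v ∈ U) (hw : w ∈ U) (ht : t ∈ V)
    (hvS : φ.symm (v, t) ∈ interior S) : φ.symm (w, t) ∈ interior S := by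
  have mem_interior_iff {q} (hq : q ∈ φ.target) :
      φ.symm q ∈ interior S ↔ ∀ᶠ q' in 𝓝 q, φ.symm q' ∈ S := by
    rw [mem_interior_iff_mem_nhds, ← φ.symm.map_nhds_eq hq, Filter.mem_map]; rfl
  rw [mem_interior_iff (hbox ⟨hv, ht⟩)] at hvS
  rw [mem_interior_iff (hbox ⟨hw, ht⟩), nhds_prod_eq]
  have hvS' : ∀ᶠ s in 𝓝 t, φ.symm (v, s) ∈ S :=
    (Continuous.prodMk_right v).continuousAt.eventually hvS
  filter_upwards [(hU.eventually_mem hw).prod_mk ((hV.eventually_mem ht).and hvS')]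
    with q ⟨hqU, hqV, hqS⟩
  exact hS (leafSetoid_of_isPreconnected hφ hU' (fun u hu => hbox ⟨hu, hqV⟩) hv hqU) hqS

theorem IsSaturated.interior {S : Set M} (hS : F.IsSaturated S) : F.IsSaturated (interior S) := by
  refine isSaturated_iff_isClopen.2 ⟨(@isClosed_iff_frequently M F.leafTopology _).2 fun x hx => ?_,
    F.leafTopology_le _ isOpen_interior⟩
  obtain ⟨φ, hφ, hxφ⟩ := F.covers x
  obtain ⟨ε, hε, hbox⟩ := exists_ball_prod_ball_subset_target hxφ
  have hfreq : ∃ᶠ y in F.leafNhds x, y ∈ _root_.interior S := hx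
  rw [leafNhds_eq_map hφ hxφ, Filter.frequently_map] at hfreq
  obtain ⟨v, hvS, hv⟩ := (hfreq.and_eventually (Metric.ball_mem_nhds _ hε)).exists
  simpa only [φ.left_inv hxφ] using hS.symm_mem_interior hφ Metric.isOpen_ball
    Metric.isPreconnected_ball Metric.isOpen_ball hbox hv (Metric.mem_ball_self hε)
    (Metric.mem_ball_self hε) hvS

end Saturated

section LeafSpaceProjection

variable {X : Type*} [TopologicalSpace X] {π : M → X}

theorem isOpenMap_mk (F : CodimOneFoliation n M) : IsOpenMap (Quotient.mk F.leafSetoid) := by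
  intro U hU
  set S := Quotient.mk F.leafSetoid ⁻¹' (Quotient.mk F.leafSetoid '' U)
  have hS : F.IsSaturated S := fun x y hxy hx => by
    have hmk : Quotient.mk F.leafSetoid x = Quotient.mk F.leafSetoid y := Quotient.sound hxy
    rwa [Set.mem_preimage, ← hmk]
  have hSint : S ⊆ interior S := by
    rintro x ⟨y, hy, hyx⟩
    have hUS : U ⊆ interior S := interior_maximal (Set.subset_preimage_image _ U) hU
    exact hS.interior (Quotient.exact hyx) (hUS hy)
  exact isQuotientMap_quot_mk.isOpen_preimage.1 (subset_interior_iff_isOpen.1 hSint)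

/-- `π` identifies `X` with the space of leaves of `F`: it is an open quotient map whose fibres are
the leaves. -/
structure IsLeafSpaceProjection (F : CodimOneFoliation n M) (π : M → X) : Prop where
  isOpenQuotientMap : IsOpenQuotientMap π
  eq_iff : ∀ {x y}, π x = π y ↔ F.leafSetoid x y

theorem isLeafSpaceProjection_homeomorph (e : F.LeafSpace ≃ₜ X) :
    F.IsLeafSpaceProjection (e ∘ Quotient.mk F.leafSetoid) where
  isOpenQuotientMap := e.isOpenQuotientMap.comp
    ⟨Quotient.mk_surjective, continuous_quot_mk, F.isOpenMap_mk⟩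
  eq_iff := e.injective.eq_iff.trans Quotient.eq

namespace IsLeafSpaceProjection

theorem isSaturated_preimage (hπ : F.IsLeafSpaceProjection π) (D : Set X) :
    F.IsSaturated (π ⁻¹' D) := fun x y hxy hx => by
  rwa [Set.mem_preimage, ← hπ.eq_iff.2 hxy]

theorem preimage_image (hπ : F.IsLeafSpaceProjection π) {A : Set M} (hA : F.IsSaturated A) :
    π ⁻¹' (π '' A) = A := by
  refine (Set.subset_preimage_image π A).antisymm' ?_
  rintro y ⟨x, hx, hxy⟩
  exact hA (hπ.eq_iff.1 hxy) hx

theorem isClosed_image (hπ : F.IsLeafSpaceProjection π) {A : Set M} (hA : F.IsSaturated A)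
    (hclosed : IsClosed A) : IsClosed (π '' A) := by
  rwa [← hπ.isOpenQuotientMap.isQuotientMap.isClosed_preimage, hπ.preimage_image hA]

theorem disjoint_image (hπ : F.IsLeafSpaceProjection π) {A B : Set M} (hA : F.IsSaturated A)
    (hB : F.IsSaturated B) (hAB : Disjoint A B) : Disjoint (π '' A) (π '' B) := by
  refine Disjoint.of_preimage hπ.isOpenQuotientMap.surjective ?_
  rwa [hπ.preimage_image hA, hπ.preimage_image hB]

theorem nhds_le_map_symm (hπ : F.IsLeafSpaceProjection π) (hφ : φ ∈ F.atlas)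
    {U : Set (LeafModel n)} {V : Set ℝ} (hU : IsOpen U) (hU' : IsPreconnected U) (hV : IsOpen V)
    (hbox : U ×ˢ V ⊆ φ.target) {v : LeafModel n} {t : ℝ} (hv : v ∈ U) (ht : t ∈ V) :
    𝓝 (π (φ.symm (v, t))) ≤ Filter.map (fun s => π (φ.symm (v, s))) (𝓝 t) := by
  have hslide : ∀ᶠ q in 𝓝 (v, t), π (φ.symm q) = π (φ.symm (v, q.2)) := by
    filter_upwards [(hU.prod hV).mem_nhds ⟨hv, ht⟩] with q ⟨hqU, hqV⟩
    exact hπ.eq_iff.2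
      (leafSetoid_of_isPreconnected hφ hU' (fun u hu => hbox ⟨hu, hqV⟩) hqU hv)
  calc 𝓝 (π (φ.symm (v, t)))
    _ ≤ Filter.map π (𝓝 (φ.symm (v, t))) := hπ.isOpenQuotientMap.isOpenMap.nhds_le _
    _ = Filter.map (fun q => π (φ.symm q)) (𝓝 (v, t)) := by
        rw [← φ.symm.map_nhds_eq (hbox ⟨hv, ht⟩), Filter.map_map]; rfl
    _ = Filter.map (fun q => π (φ.symm (v, q.2))) (𝓝 (v, t)) := Filter.map_congr hslide
    _ = Filter.map (fun s => π (φ.symm (v, s))) (𝓝 t) := by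
        rw [← map_snd_nhds (v, t), Filter.map_map]; rfl

theorem eventually_snd_eq_of_eq [LinearOrder X] [OrderTopology X] [DenselyOrdered X] [NoMinOrder X]
    [NoMaxOrder X] (hπ : F.IsLeafSpaceProjection π) (hφ : φ ∈ F.atlas) (hx : x ∈ φ.source) :
    ∀ᶠ z in 𝓝 x, π z = π x → (φ z).2 = (φ x).2 := by
  obtain ⟨ε, hε, hbox⟩ := exists_ball_prod_ball_subset_target hx
  set U := Metric.ball (φ x).1 ε
  set V := Metric.ball (φ x).2 ε with hV
  have hxU : (φ x).1 ∈ U := Metric.mem_ball_self hε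
  have hxV : (φ x).2 ∈ V := Metric.mem_ball_self hε
  have hinj : Set.InjOn (fun t => π (φ.symm ((φ x).1, t))) V := by
    refine injOn_of_nhds_le_map (hV ▸ Real.ball_eq_Ioo _ _ ▸ Set.ordConnected_Ioo) ?_
      fun t ht => hπ.nhds_le_map_symm hφ Metric.isOpen_ball Metric.isPreconnected_ball
        Metric.isOpen_ball hbox hxU ht
    exact hπ.isOpenQuotientMap.continuous.comp_continuousOn
      (φ.symm.continuousOn.comp (by fun_prop) fun t ht => hbox ⟨hxU, ht⟩)
  have hφx : ContinuousAt φ x := φ.continuousAt hx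
  filter_upwards [φ.open_source.mem_nhds hx, hφx.fst.eventually (Metric.ball_mem_nhds _ hε),
    hφx.snd.eventually (Metric.ball_mem_nhds _ hε)] with z hz hzU hzV hzx
  refine hinj hzV hxV ?_
  have hslide := hπ.eq_iff.2 (leafSetoid_of_isPreconnected hφ Metric.isPreconnected_ball
    (fun u hu => hbox ⟨hu, hzV⟩) hxU hzU)
  simpa only [Prod.mk.eta, φ.left_inv hz, φ.left_inv hx, hzx] using hslide

theorem nhdsWithin_preimage_le_leafNhds [LinearOrder X] [OrderTopology X] [DenselyOrdered X]
    [NoMinOrder X] [NoMaxOrder X] (hπ : F.IsLeafSpaceProjection π) {D : Set X}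
    (hD : IsDiscrete D) (hx : π x ∈ D) : 𝓝[π ⁻¹' D] x ≤ F.leafNhds x := by
  obtain ⟨φ, hφ, hxφ⟩ := F.covers x
  have hfibre : ∀ᶠ z in 𝓝[π ⁻¹' D] x, π z = π x := by
    have htendsto : Filter.Tendsto π (𝓝[π ⁻¹' D] x) (𝓝[D] π x) :=
      hπ.isOpenQuotientMap.continuous.continuousWithinAt.tendsto_nhdsWithin
        (Set.mapsTo_preimage π D)
    rwa [isDiscrete_iff_nhdsWithin.1 hD _ hx, Filter.tendsto_pure] at htendsto
  refine nhdsWithin_le_leafNhds hφ hxφ ?_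
  filter_upwards [hfibre, mem_nhdsWithin_of_mem_nhds (hπ.eventually_snd_eq_of_eq hφ hxφ)]
    with z hz hzx using hzx hz

end IsLeafSpaceProjection

end LeafSpaceProjection

section Covering

theorem locallyPathConnectedSpace (F : CodimOneFoliation n M) : LocallyPathConnectedSpace M := by
  choose φ _ hx using F.covers
  let : ChartedSpace (LeafModel n × ℝ) M :=
    { atlas := Set.range φ
      chartAt := φ
      mem_chart_source := hx
      chart_mem_atlas := fun x => ⟨x, rfl⟩ }
  exact ChartedSpace.locallyPathConnectedSpace (LeafModel n × ℝ) M

variable {E : Type u} [TopologicalSpace E] {p : E → M}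

theorem map_leafNhds {E : Type*} [TopologicalSpace E] {G : CodimOneFoliation n E} {τ : E → M}
    {χ : OpenPartialHomeomorph E (LeafModel n × ℝ)} (hχ : χ ∈ G.atlas) (hφ : φ ∈ F.atlas)
    (hmaps : Set.MapsTo τ χ.source φ.source) (heq : Set.EqOn χ (φ ∘ τ) χ.source) {x : E}
    (hx : x ∈ χ.source) : Filter.map τ (G.leafNhds x) = F.leafNhds (τ x) := by
  have hχx : χ x = φ (τ x) := heq hx
  have hslice : ContinuousAt (fun v => (v, (χ x).2)) (χ x).1 := by fun_prop
  have hτ : ∀ᶠ v in 𝓝 (χ x).1, τ (χ.symm (v, (χ x).2)) = φ.symm (v, (χ x).2) := by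
    filter_upwards [hslice.eventually (χ.open_target.mem_nhds (χ.map_source hx))] with v hv
    have hsource := χ.map_target hv
    have hφv : φ (τ (χ.symm (v, (χ x).2))) = (v, (χ x).2) :=
      (heq hsource).symm.trans (χ.right_inv hv)
    exact (φ.left_inv (hmaps hsource)).symm.trans (congrArg φ.symm hφv)
  rw [leafNhds_eq_map hχ hx, leafNhds_eq_map hφ (hmaps hx), Filter.map_map, ← hχx]
  exact Filter.map_congr hτ

theorem map_leafNhds_lift (hp : IsLocalHomeomorph p) (x : E) :
    Filter.map p ((F.lift p hp).leafNhds x) = F.leafNhds (p x) := by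
  obtain ⟨χ, ⟨φ, hφ, hmaps, heq⟩, hx⟩ := (F.lift p hp).covers x
  have hχ : χ ∈ (F.lift p hp).atlas := ⟨φ, hφ, hmaps, heq⟩
  exact map_leafNhds hχ hφ hmaps heq hx

theorem map_leafNhds_deck (hp : IsLocalHomeomorph p) {τ : E → E} (hτ : IsLocalHomeomorph τ)
    (hpτ : p ∘ τ = p) (x : E) :
    Filter.map τ ((F.lift p hp).leafNhds x) = (F.lift p hp).leafNhds (τ x) := by
  obtain ⟨χ, ⟨ψ, ⟨φ, hφ, hψφ, hψ⟩, hmaps, heq⟩, hx⟩ := ((F.lift p hp).lift τ hτ).covers x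
  have hχ : χ ∈ (F.lift p hp).atlas := by
    refine ⟨φ, hφ, hpτ ▸ hψφ.comp hmaps, fun z hz => ?_⟩
    rw [heq hz, ← hpτ]
    exact hψ (hmaps hz)
  have hψ' : ψ ∈ (F.lift p hp).atlas := ⟨φ, hφ, hψφ, hψ⟩
  exact map_leafNhds hχ hψ' hmaps heq hx

theorem leafSetoid_map {E : Type*} [TopologicalSpace E] {G : CodimOneFoliation n E} {τ : E → M}
    (hτ : ∀ x, Filter.map τ (G.leafNhds x) = F.leafNhds (τ x)) {x y : E}
    (hxy : G.leafSetoid x y) : F.leafSetoid (τ x) (τ y) := by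
  have hcont : Continuous[G.leafTopology, F.leafTopology] τ :=
    (@continuous_iff_continuousAt _ _ G.leafTopology F.leafTopology τ).2 fun x => (hτ x).le
  exact leafSetoid_iff.2 (@Continuous.image_connectedComponent_subset _ _ G.leafTopology
    F.leafTopology τ hcont x _ ⟨y, leafSetoid_iff.1 hxy, rfl⟩)

theorem IsSaturated.preimage_lift {A : Set M} (hA : F.IsSaturated A) (hp : IsLocalHomeomorph p) :
    (F.lift p hp).IsSaturated (p ⁻¹' A) :=
  fun _ _ hxy => hA (leafSetoid_map (map_leafNhds_lift hp) hxy)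

theorem IsSaturated.image_lift {hp : IsLocalHomeomorph p} {T : Set E}
    (hT : (F.lift p hp).IsSaturated T) (hclosed : IsClosed (p '' T)) : F.IsSaturated (p '' T) := by
  refine isSaturated_of_eventually_mem hclosed ?_
  rintro _ ⟨x, hx, rfl⟩
  rw [← map_leafNhds_lift hp, Filter.eventually_map]
  exact ((F.lift p hp).eventually_leafSetoid x).mono fun y hxy => ⟨y, hT hxy hx, rfl⟩

theorem exists_deck [SimplyConnectedSpace E] [LocallyPathConnectedSpace E]
    (hp : IsCoveringMap p) {x y : E} (hxy : p y = p x) :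
    ∃ τ : E → E, IsLocalHomeomorph τ ∧ p ∘ τ = p ∧ τ x = y := by
  obtain ⟨τ, ⟨hτx, hpτ⟩, -⟩ := hp.existsUnique_continuousMap_lifts ⟨p, hp.continuous⟩ x y hxy
  have hcomp : IsLocalHomeomorph (p ∘ τ) := hpτ ▸ hp.isLocalHomeomorph
  exact ⟨τ, hcomp.of_comp hp.isLocalHomeomorph τ.continuous, hpτ, hτx⟩

theorem IsLeafSpaceProjection.exists_continuous_comp_eq {X : Type*} [TopologicalSpace X] {π : M → X}
    (hπ : F.IsLeafSpaceProjection π) {τ : M → M} (hτ : Continuous τ)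
    (hτleaf : ∀ {x y}, F.leafSetoid x y → F.leafSetoid (τ x) (τ y)) :
    ∃ σ : X → X, Continuous σ ∧ σ ∘ π = π ∘ τ := by
  have hcont : Continuous π := hπ.isOpenQuotientMap.continuous
  have hquot : Topology.IsQuotientMap (⟨π, hcont⟩ : C(M, X)) := hπ.isOpenQuotientMap.isQuotientMap
  have hfibre (x y : M) (hxy : π x = π y) : π (τ x) = π (τ y) :=
    hπ.eq_iff.2 (hτleaf (hπ.eq_iff.1 hxy))
  let πτ : C(M, X) := ⟨π ∘ τ, hcont.comp hτ⟩
  exact ⟨hquot.lift πτ hfibre, map_continuous _,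
    congrArg DFunLike.coe (hquot.lift_comp πτ hfibre)⟩

theorem IsLeafSpaceProjection.preimage_transitionSet_of_eq [SimplyConnectedSpace E]
    (hp : IsCoveringMap p) {X : Type*} [TopologicalSpace X] {π : E → X}
    (hπ : (F.lift p hp.isLocalHomeomorph).IsLeafSpaceProjection π) {A B : Set M}
    (hA : F.IsSaturated A) (hB : F.IsSaturated B) {x y : E} (hxy : p y = p x)
    (hx : π x ∈ transitionSet (π '' (p ⁻¹' A)) (π '' (p ⁻¹' B))) :
    π y ∈ transitionSet (π '' (p ⁻¹' A)) (π '' (p ⁻¹' B)) := by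
  have hpl := hp.isLocalHomeomorph
  have := (F.lift p hpl).locallyPathConnectedSpace
  obtain ⟨τ, hτ, hpτ, rfl⟩ := exists_deck hp hxy
  obtain ⟨σ, hσ, hσπ⟩ := hπ.exists_continuous_comp_eq hτ.continuous
    (leafSetoid_map (map_leafNhds_deck hpl hτ hpτ))
  have hinv {C : Set M} (hC : F.IsSaturated C) :
      σ ⁻¹' (π '' (p ⁻¹' C)) = π '' (p ⁻¹' C) := by
    refine hπ.isOpenQuotientMap.surjective.preimage_injective ?_
    rw [← Set.preimage_comp, hσπ, Set.preimage_comp, hπ.preimage_image (hC.preimage_lift hpl),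
      ← Set.preimage_comp, hpτ]
  rw [← hinv hA, ← hinv hB] at hx
  have hσx := map_mem_transitionSet hσ hx
  rwa [← Function.comp_apply (f := σ), hσπ] at hσx

theorem IsLeafSpaceProjection.isCompactLeaf_of_isDiscrete [CompactSpace M] {X : Type*}
    [LinearOrder X] [TopologicalSpace X] [OrderTopology X] [DenselyOrdered X] [NoMinOrder X]
    [NoMaxOrder X] {π : E → X} {hp : IsLocalHomeomorph p} (hsurj : Function.Surjective p)
    (hπ : (F.lift p hp).IsLeafSpaceProjection π) {D : Set X} (hDclosed : IsClosed D)
    (hDdiscrete : IsDiscrete D) (hDinv : ∀ x y, p y = p x → π x ∈ D → π y ∈ D) {x : E}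
    (hx : π x ∈ D) : F.IsCompactLeaf (p x) := by
  set K := p '' (π ⁻¹' D)
  have hpK : p ⁻¹' K = π ⁻¹' D := by
    refine (Set.subset_preimage_image p _).antisymm' ?_
    rintro y ⟨z, hz, hzy⟩
    exact hDinv z y hzy.symm hz
  have hKclosed : IsClosed K := by
    rw [← (hp.isOpenMap.isQuotientMap hp.continuous hsurj).isClosed_preimage, hpK]
    exact hDclosed.preimage hπ.isOpenQuotientMap.continuous
  have hnhds : ∀ z ∈ K, 𝓝[K] z ≤ F.leafNhds z := by
    rintro _ ⟨z, hz, rfl⟩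
    rw [nhdsWithin, ← hp.map_nhds_eq, ← Filter.map_inf_principal_preimage, hpK]
    exact (Filter.map_mono (hπ.nhdsWithin_preimage_le_leafNhds hDdiscrete hz)).trans_eq
      (map_leafNhds_lift hp z)
  have hcont : @ContinuousOn M M _ F.leafTopology id K := hnhds
  have hKcompact : @IsCompact M F.leafTopology K := by
    rw [← Set.image_id K]
    exact @IsCompact.image_of_continuousOn M M _ F.leafTopology _ _ hKclosed.isCompact hcont
  exact (IsSaturated.image_lift (hπ.isSaturated_preimage D) hKclosed).isCompactLeaf hKcompact
    ⟨x, hx, rfl⟩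

theorem IsRCovered.exists_isCompactLeaf [CompactSpace M] [ConnectedSpace M] (hF : F.IsRCovered)
    {A B : Set M} (hA : F.IsSaturated A) (hB : F.IsSaturated B) (hAclosed : IsClosed A)
    (hBclosed : IsClosed B) (hAne : A.Nonempty) (hBne : B.Nonempty) (hAB : Disjoint A B) :
    ∃ x, F.IsCompactLeaf x := by
  obtain ⟨E, _, _, p, hp, ⟨e⟩⟩ := hF
  have hsurj : Function.Surjective p := surjective_of_isCoveringMap hp
  have hpl := hp.isLocalHomeomorph
  have hπ := isLeafSpaceProjection_homeomorph e
  set π := e ∘ Quotient.mk (F.lift p hpl).leafSetoid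
  have hA' := hA.preimage_lift hpl
  have hB' := hB.preimage_lift hpl
  have hA'closed := hπ.isClosed_image hA' (hAclosed.preimage hp.continuous)
  have hB'closed := hπ.isClosed_image hB' (hBclosed.preimage hp.continuous)
  obtain ⟨hDclosed, hDdiscrete⟩ := isClosed_and_isDiscrete_transitionSet hA'closed hB'closed
    (hπ.disjoint_image hA' hB' (hAB.preimage p))
  obtain ⟨d, hd⟩ := transitionSet_nonempty hA'closed hB'closed ((hAne.preimage hsurj).image π)
    ((hBne.preimage hsurj).image π)
  obtain ⟨x, rfl⟩ := hπ.isOpenQuotientMap.surjective d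
  exact ⟨p x, hπ.isCompactLeaf_of_isDiscrete hsurj hDclosed hDdiscrete
    (fun _ _ hxy => hπ.preimage_transitionSet_of_eq hp hA hB hxy) hd⟩

end Covering

end CodimOneFoliation

noncomputable section

section SecondDerivative

variable {E : Type*} [NormedAddCommGroup E] [NormedSpace ℝ E] {u v : E → ℝ} {x : E}

theorem deriv_deriv_nonpos_of_isLocalMax {c : ℝ → ℝ} {t : ℝ} (hc : ContinuousAt c t)
    (hmax : IsLocalMax c t) : deriv (deriv c) t ≤ 0 := by
  by_contra! hpos
  have hmin : IsLocalMin c t := isLocalMin_of_deriv_deriv_pos hpos hmax.deriv_eq_zero hc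
  have hconst : c =ᶠ[𝓝 t] fun _ => c t := by
    filter_upwards [hmax, hmin] with s hle hge using le_antisymm hle hge
  simp [hconst.deriv.deriv_eq] at hpos

theorem differentiableAt_fderiv_of_contDiffAt (hu : ContDiffAt ℝ 2 u x) :
    DifferentiableAt ℝ (fderiv ℝ u) x :=
  (hu.fderiv_right (m := 1) le_rfl).differentiableAt one_ne_zero

theorem eventually_differentiableAt_of_contDiffAt (hu : ContDiffAt ℝ 2 u x) :
    ∀ᶠ y in 𝓝 x, DifferentiableAt ℝ u y :=
  (hu.eventually (by simp)).mono fun _ hy => hy.differentiableAt two_ne_zero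

theorem deriv_deriv_comp_line (hu : ContDiffAt ℝ 2 u x) (w : E) :
    deriv (deriv fun t : ℝ => u (x + t • w)) 0 = fderiv ℝ (fderiv ℝ u) x w w := by
  have hline (t : ℝ) : HasDerivAt (fun t : ℝ => x + t • w) w t := by
    simpa using ((hasDerivAt_id t).smul_const w).const_add x
  have hline₀ : Filter.Tendsto (fun t : ℝ => x + t • w) (𝓝 0) (𝓝 x) := by
    have hcont : Continuous fun t : ℝ => x + t • w := by fun_prop
    exact hcont.tendsto' 0 x (by simp)
  have hderiv : deriv (fun t : ℝ => u (x + t • w)) =ᶠ[𝓝 0] fun t => fderiv ℝ u (x + t • w) w := by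
    filter_upwards [hline₀.eventually (eventually_differentiableAt_of_contDiffAt hu)] with t ht
    exact (ht.hasFDerivAt.comp_hasDerivAt t (hline t)).deriv
  have hfderiv : HasFDerivAt (fun y => fderiv ℝ u y w) ((fderiv ℝ (fderiv ℝ u) x).flip w) x := by
    simpa using (differentiableAt_fderiv_of_contDiffAt hu).hasFDerivAt.clm_apply
      (hasFDerivAt_const w x)
  rw [hderiv.deriv_eq]
  exact (hfderiv.comp_hasDerivAt_of_eq 0 (hline 0) (by simp)).deriv

theorem fderiv_fderiv_nonpos_of_isLocalMax (hu : ContDiffAt ℝ 2 u x) (hmax : IsLocalMax u x)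
    (w : E) : fderiv ℝ (fderiv ℝ u) x w w ≤ 0 := by
  have hline : ContinuousAt (fun t : ℝ => x + t • w) 0 := by fun_prop
  have hx : x + (0 : ℝ) • w = x := by simp
  rw [← deriv_deriv_comp_line hu]
  refine deriv_deriv_nonpos_of_isLocalMax (hu.continuousAt.comp_of_eq hline hx) ?_
  have hmax' : ∀ᶠ y in 𝓝 (x + (0 : ℝ) • w), u y ≤ u (x + (0 : ℝ) • w) := by rwa [hx]
  exact hline.eventually hmax'

theorem fderiv_fderiv_add_const_mul (hu : ContDiffAt ℝ 2 u x) (hv : ContDiffAt ℝ 2 v x) (ε : ℝ) :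
    fderiv ℝ (fderiv ℝ fun y => u y + ε * v y) x =
      fderiv ℝ (fderiv ℝ u) x + ε • fderiv ℝ (fderiv ℝ v) x := by
  have hfderiv : fderiv ℝ (fun y => u y + ε * v y) =ᶠ[𝓝 x]
      fun y => fderiv ℝ u y + ε • fderiv ℝ v y := by
    filter_upwards [eventually_differentiableAt_of_contDiffAt hu,
      eventually_differentiableAt_of_contDiffAt hv] with y huy hvy
    exact (huy.hasFDerivAt.add (hvy.hasFDerivAt.const_mul ε)).fderiv
  rw [hfderiv.fderiv_eq]
  exact ((differentiableAt_fderiv_of_contDiffAt hu).hasFDerivAt.add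
    ((differentiableAt_fderiv_of_contDiffAt hv).hasFDerivAt.const_smul ε)).fderiv

theorem fderiv_fderiv_sq_of_eq_zero (hu : ContDiffAt ℝ 2 u x) (hux : u x = 0) :
    fderiv ℝ (fderiv ℝ fun y => u y ^ 2) x = (2 : ℝ) • (fderiv ℝ u x).smulRight (fderiv ℝ u x) := by
  have hfderiv : fderiv ℝ (fun y => u y ^ 2) =ᶠ[𝓝 x] fun y => (2 * u y) • fderiv ℝ u y := by
    filter_upwards [eventually_differentiableAt_of_contDiffAt hu] with y huy
    simpa using (huy.hasFDerivAt.pow 2).fderiv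
  have hux' : HasFDerivAt (fun y => 2 * u y) ((2 : ℝ) • fderiv ℝ u x) x :=
    (hu.differentiableAt two_ne_zero).hasFDerivAt.const_mul 2
  rw [hfderiv.fderiv_eq,
    (hux'.fun_smul (differentiableAt_fderiv_of_contDiffAt hu).hasFDerivAt).fderiv, hux]
  ext
  simp [mul_assoc]

end SecondDerivative

section MaximumPrinciple

set_option maxSynthPendingDepth 3

section NormedSpace

variable {E : Type*} [NormedAddCommGroup E] [NormedSpace ℝ E]
  {A : E → (E →L[ℝ] E →L[ℝ] ℝ) →L[ℝ] ℝ} {b : E → E} {u v : E → ℝ} {x : E}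

/-- The second-order linear differential operator `u ↦ ⟨A, D²u⟩ + Du(b)` without zeroth-order term.
Its principal coefficient at `x` is encoded, without coordinates, as a linear form `A x` on bilinear
forms; in coordinates this is `H ↦ ∑ i j, aⁱʲ(x) Hᵢⱼ`. -/
def secondOrderOp (A : E → (E →L[ℝ] E →L[ℝ] ℝ) →L[ℝ] ℝ) (b : E → E) (u : E → ℝ) (x : E) : ℝ :=
  A x (fderiv ℝ (fderiv ℝ u) x) + fderiv ℝ u x (b x)

/-- Ellipticity of the principal coefficient `T` of a second-order operator at a point: in
coordinates, the matrix `aⁱʲ` is positive definite. -/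
structure IsElliptic (T : (E →L[ℝ] E →L[ℝ] ℝ) →L[ℝ] ℝ) : Prop where
  nonpos : ∀ {H : E →L[ℝ] E →L[ℝ] ℝ}, (∀ w, H w w ≤ 0) → T H ≤ 0
  smulRight_pos : ∀ {ℓ : E →L[ℝ] ℝ}, ℓ ≠ 0 → 0 < T (ℓ.smulRight ℓ)

theorem secondOrderOp_add_const_mul (hu : ContDiffAt ℝ 2 u x) (hv : ContDiffAt ℝ 2 v x) (ε : ℝ) :
    secondOrderOp A b (fun y => u y + ε * v y) x =
      secondOrderOp A b u x + ε * secondOrderOp A b v x := by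
  have hu' := (hu.differentiableAt two_ne_zero).hasFDerivAt
  have hv' := (hv.differentiableAt two_ne_zero).hasFDerivAt
  rw [secondOrderOp, fderiv_fderiv_add_const_mul hu hv, (hu'.fun_add (hv'.const_mul ε)).fderiv]
  simp only [secondOrderOp, map_add, map_smul, add_apply, smul_apply, smul_eq_mul]
  ring

theorem secondOrderOp_sq_of_eq_zero (hu : ContDiffAt ℝ 2 u x) (hux : u x = 0) :
    secondOrderOp A b (fun y => u y ^ 2) x =
      2 * A x ((fderiv ℝ u x).smulRight (fderiv ℝ u x)) := by
  have hu' := (hu.differentiableAt two_ne_zero).hasFDerivAt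
  rw [secondOrderOp, fderiv_fderiv_sq_of_eq_zero hu hux, (hu'.pow 2).fderiv]
  simp [hux]

theorem continuousAt_secondOrderOp (hA : ContinuousAt A x) (hb : ContinuousAt b x)
    (hu : ContDiffAt ℝ 2 u x) : ContinuousAt (secondOrderOp A b u) x := by
  have hu' : ContDiffAt ℝ 1 (fderiv ℝ u) x := hu.fderiv_right le_rfl
  exact (hA.clm_apply (hu'.fderiv_right (m := 0) le_rfl).continuousAt).add
    (hu'.continuousAt.clm_apply hb)

theorem not_isLocalMax_of_secondOrderOp_pos (hA : IsElliptic (A x)) (hu : ContDiffAt ℝ 2 u x)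
    (hpos : 0 < secondOrderOp A b u x) : ¬ IsLocalMax u x := fun hmax => by
  rw [secondOrderOp, hmax.fderiv_eq_zero, zero_apply, add_zero] at hpos
  exact hpos.not_ge (hA.nonpos (fderiv_fderiv_nonpos_of_isLocalMax hu hmax))

theorem exists_pos_forall_add_mul_lt {X : Type*} [TopologicalSpace X] [CompactSpace X]
    {u h : X → ℝ} (hu : Continuous u) (hh : Continuous h) {m : ℝ} (hm : ∀ x, u x ≤ m)
    (hneg : ∀ x, u x = m → h x < 0) : ∃ ε > 0, ∀ x, u x + ε * h x < m := by
  have hlocal (x : X) : ∀ᶠ q : ℝ × X in 𝓝 (0, x), 0 < q.1 → u q.2 + q.1 * h q.2 < m := by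
    rcases (hm x).lt_or_eq with hx | hx
    · have hcont : Continuous fun q : ℝ × X => u q.2 + q.1 * h q.2 := by fun_prop
      filter_upwards [hcont.continuousAt.eventually_lt_const (by simpa using hx)] with q hq _
      exact hq
    · have hcont : Continuous fun q : ℝ × X => h q.2 := by fun_prop
      filter_upwards [hcont.continuousAt.eventually_lt_const (hneg x hx)] with q hq hε
      linarith [hm q.2, mul_neg_of_pos_of_neg hε hq]
  have hforall : ∀ᶠ ε : ℝ in 𝓝 0, ∀ x ∈ Set.univ, 0 < ε → u x + ε * h x < m :=
    isCompact_univ.eventually_forall_of_forall_eventually fun x _ => hlocal x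
  obtain ⟨ε, hε, hεpos⟩ := (hforall.and_frequently (frequently_gt_nhds 0)).exists
  exact ⟨ε, hεpos, fun x => hε x trivial hεpos⟩

end NormedSpace

variable {E : Type*} [NormedAddCommGroup E] [InnerProductSpace ℝ E]
  {A : E → (E →L[ℝ] E →L[ℝ] ℝ) →L[ℝ] ℝ} {b : E → E} {u s : E → ℝ} {x z : E}

theorem exists_barrier (hA : IsElliptic (A z)) (hAz : ContinuousAt A z) (hbz : ContinuousAt b z)
    (hs : ContDiffAt ℝ 2 s z) (hsz : s z = 0) (hs' : fderiv ℝ s z ≠ 0) :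
    ∃ h : E → ℝ, ContDiffAt ℝ 2 h z ∧ h z = 0 ∧ (∀ᶠ x in 𝓝 z, 0 < secondOrderOp A b h x) ∧
      ∀ᶠ x in 𝓝 z, x ≠ z → s x ≤ 0 → h x < 0 := by
  have hq : ContDiffAt ℝ 2 (fun x => s x - ‖x - z‖ ^ 2) z :=
    hs.sub ((contDiffAt_id.sub contDiffAt_const).norm_sq ℝ)
  set P := A z ((fderiv ℝ s z).smulRight (fderiv ℝ s z)) with hP
  set C := secondOrderOp A b (fun x => s x - ‖x - z‖ ^ 2) z with hC
  have hPpos : 0 < P := hA.smulRight_pos hs'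
  set β := (1 - C) / (2 * P) with hβ
  have hh : ContDiffAt ℝ 2 (fun x => s x - ‖x - z‖ ^ 2 + β * s x ^ 2) z :=
    hq.add (contDiffAt_const.mul (hs.pow 2))
  -- At `z` the operator sends `s ^ 2` to `2 * P`, so `β` makes its value on the barrier `1`.
  refine ⟨_, hh, by simp [hsz], ?_, ?_⟩
  · refine (continuousAt_secondOrderOp hAz hbz hh).eventually_const_lt ?_
    rw [secondOrderOp_add_const_mul hq (hs.pow 2), secondOrderOp_sq_of_eq_zero hs hsz, ← hP, ← hC,
      hβ, div_mul_cancel₀ _ (by positivity)]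
    linarith
  · have hfactor : ContinuousAt (fun x => 1 + β * s x) z :=
      continuousAt_const.add (continuousAt_const.mul hs.continuousAt)
    filter_upwards [hfactor.eventually_const_lt (by simp [hsz] : (0 : ℝ) < 1 + β * s z)]
      with x hx hxz hsx
    have hxz' : 0 < ‖x - z‖ ^ 2 := pow_pos (norm_pos_iff.2 (sub_ne_zero.2 hxz)) 2
    linarith [mul_nonpos_of_nonpos_of_nonneg hsx hx.le]

theorem frequently_pos_and_eq_of_isLocalMax [ProperSpace E]
    (hA : ∀ᶠ x in 𝓝 z, IsElliptic (A x)) (hAz : ContinuousAt A z) (hbz : ContinuousAt b z)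
    (hu : ContDiffAt ℝ 2 u z) (hLu : ∀ᶠ x in 𝓝 z, 0 ≤ secondOrderOp A b u x)
    (hmax : IsLocalMax u z) (hs : ContDiffAt ℝ 2 s z) (hsz : s z = 0) (hs' : fderiv ℝ s z ≠ 0) :
    ∃ᶠ x in 𝓝 z, 0 < s x ∧ u x = u z := fun hnot => by
  obtain ⟨h, hh, hhz, hLh, hneg⟩ := exists_barrier (b := b) hA.self_of_nhds hAz hbz hs hsz hs'
  have hneg' : ∀ᶠ x in 𝓝 z, x ≠ z → u x = u z → h x < 0 := by
    filter_upwards [hnot, hneg] with x hx hhx hxz hux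
    exact hhx hxz (not_lt.1 fun hsx => hx ⟨hsx, hux⟩)
  obtain ⟨δ, hδ, hball⟩ := Metric.nhds_basis_closedBall.eventually_iff.1
    ((hA.and (hLu.and hLh)).and (((hu.eventually (by simp)).and (hh.eventually (by simp))).and
      (hmax.and hneg')))
  have hucont : ContinuousOn u (Metric.closedBall z δ) := fun x hx =>
    (hball hx).2.1.1.continuousAt.continuousWithinAt
  have hhcont : ContinuousOn h (Metric.closedBall z δ) := fun x hx =>
    (hball hx).2.1.2.continuousAt.continuousWithinAt
  have hsphere : Metric.sphere z δ ⊆ Metric.closedBall z δ := Metric.sphere_subset_closedBall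
  obtain ⟨ε, hε, hlt⟩ := exists_pos_forall_add_mul_lt (hucont.mono hsphere).domRestrict
    (hhcont.mono hsphere).domRestrict (fun x => (hball (hsphere x.2)).2.2.1)
    fun x => (hball (hsphere x.2)).2.2.2 (Metric.ne_of_mem_sphere x.2 hδ.ne')
  obtain ⟨ξ, hξ, hξmax⟩ := (isCompact_closedBall z δ).exists_isLocalMax_mem_open
    (f := fun x => u x + ε * h x) Metric.ball_subset_closedBall
    (hucont.add (continuousOn_const.mul hhcont)) (Metric.mem_closedBall_self hδ.le)
    (fun x hx => by
      rw [Metric.closedBall_sdiff_ball] at hx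
      simpa [hhz] using hlt ⟨x, hx⟩) Metric.isOpen_ball
  obtain ⟨⟨hAξ, hLuξ, hLhξ⟩, ⟨huξ, hhξ⟩, -⟩ := hball (Metric.ball_subset_closedBall hξ)
  refine not_isLocalMax_of_secondOrderOp_pos (b := b) hAξ (huξ.add (contDiffAt_const.mul hhξ)) ?_
    hξmax
  rw [secondOrderOp_add_const_mul huξ hhξ]
  exact add_pos_of_nonneg_of_pos hLuξ (mul_pos hε hLhξ)

theorem fderiv_const_sub_norm_sub_sq_ne_zero {a : E} (hza : z ≠ a) (c : ℝ) :
    fderiv ℝ (fun x => c - ‖x - a‖ ^ 2) z ≠ 0 := fun hzero => by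
  have hderiv := (((hasFDerivAt_id z).sub_const a).norm_sq.const_sub c).fderiv
  have happly := DFunLike.congr_fun (hderiv.symm.trans hzero) (z - a)
  simp only [id_eq, neg_apply, smul_apply, ContinuousLinearMap.comp_apply, innerSL_apply_apply,
    ContinuousLinearMap.id_apply, zero_apply, neg_eq_zero] at happly
  simp [sub_eq_zero, hza] at happly

theorem eventually_eq_of_isLocalMax [ProperSpace E] (hA : ∀ᶠ x in 𝓝 z, IsElliptic (A x))
    (hAcont : ∀ᶠ x in 𝓝 z, ContinuousAt A x) (hbcont : ∀ᶠ x in 𝓝 z, ContinuousAt b x)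
    (hu : ContDiffAt ℝ 2 u z) (hLu : ∀ᶠ x in 𝓝 z, 0 ≤ secondOrderOp A b u x)
    (hmax : IsLocalMax u z) : ∀ᶠ x in 𝓝 z, u x = u z := by
  obtain ⟨R, hR, hball⟩ := Metric.nhds_basis_ball.eventually_iff.1
    (((hA.eventually_nhds.and hLu.eventually_nhds).and (hAcont.and hbcont)).and
      ((hu.eventually (by simp)).and hmax.eventually_nhds))
  filter_upwards [Metric.ball_mem_nhds z (half_pos hR)] with a ha
  by_contra hua
  have hsub : Metric.closedBall a (dist z a) ⊆ Metric.ball z R := fun x hx => by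
    rw [Metric.mem_closedBall, dist_comm z a] at hx
    rw [Metric.mem_ball] at ha ⊢
    linarith [dist_triangle x a z]
  have hucont : ContinuousOn u (Metric.closedBall a (dist z a)) := fun x hx =>
    (hball (hsub hx)).2.1.continuousAt.continuousWithinAt
  have hcompact : IsCompact (Metric.closedBall a (dist z a) ∩ u ⁻¹' {u z}) :=
    (isCompact_closedBall _ _).of_isClosed_subset
      (hucont.preimage_isClosed_of_isClosed Metric.isClosed_closedBall isClosed_singleton)
      Set.inter_subset_left
  obtain ⟨y, ⟨hy, huy : u y = u z⟩, hnearest⟩ := hcompact.exists_isMinOn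
    ⟨z, Metric.mem_closedBall.2 le_rfl, rfl⟩ (f := fun x => dist x a) (by fun_prop)
  obtain ⟨⟨⟨hAy, hLy⟩, hAy', hby⟩, huy', hmaxy⟩ := hball (hsub hy)
  have hya : y ≠ a := by rintro rfl; exact hua huy
  have hlocalMax : IsLocalMax u y := hmaxy.mono fun x hx => hx.trans_eq huy.symm
  obtain ⟨x, hxpos, hux⟩ := (frequently_pos_and_eq_of_isLocalMax hAy hAy' hby huy' hLy hlocalMax
    (s := fun x => ‖y - a‖ ^ 2 - ‖x - a‖ ^ 2)
    (contDiffAt_const.sub ((contDiffAt_id.sub contDiffAt_const).norm_sq ℝ)) (sub_self _)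
    (fderiv_const_sub_norm_sub_sq_ne_zero hya _)).exists
  have hxy : dist x a < dist y a := by
    simpa only [dist_eq_norm] using lt_of_pow_lt_pow_left₀ 2 (norm_nonneg _) (sub_pos.1 hxpos)
  exact hxy.not_ge (hnearest ⟨hxy.le.trans hy, hux.trans huy⟩)

end MaximumPrinciple

section LaplaceBeltrami

set_option maxSynthPendingDepth 3

section Contraction

variable {ι : Type*} [Fintype ι] [DecidableEq ι]

/-- The full contraction `H ↦ ∑ i j, aⁱʲ Hᵢⱼ` of bilinear forms with the matrix `a`: the coordinate
form of the principal coefficient of a second-order operator. -/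
def bilinContraction : Matrix ι ι ℝ →ₗ[ℝ]
    (EuclideanSpace ℝ ι →L[ℝ] EuclideanSpace ℝ ι →L[ℝ] ℝ) →L[ℝ] ℝ :=
  ∑ i, ∑ j, (Matrix.entryLinearMap ℝ ℝ i j).smulRight
    ((ContinuousLinearMap.apply ℝ ℝ (EuclideanSpace.single j 1)).comp
      (ContinuousLinearMap.apply ℝ (EuclideanSpace ℝ ι →L[ℝ] ℝ) (EuclideanSpace.single i 1)))

theorem bilinContraction_apply (a : Matrix ι ι ℝ)
    (H : EuclideanSpace ℝ ι →L[ℝ] EuclideanSpace ℝ ι →L[ℝ] ℝ) :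
    bilinContraction a H =
      ∑ i, ∑ j, a i j * H (EuclideanSpace.single i 1) (EuclideanSpace.single j 1) := by
  simp [bilinContraction]

theorem toLp_eq_sum_smul_single (v : ι → ℝ) :
    WithLp.toLp 2 v = ∑ i, v i • EuclideanSpace.single i (1 : ℝ) := by
  simpa using ((EuclideanSpace.basisFun ι ℝ).sum_repr (WithLp.toLp 2 v)).symm

theorem bilinContraction_vecMulVec (v w : ι → ℝ)
    (H : EuclideanSpace ℝ ι →L[ℝ] EuclideanSpace ℝ ι →L[ℝ] ℝ) :
    bilinContraction (Matrix.vecMulVec v w) H = H (WithLp.toLp 2 v) (WithLp.toLp 2 w) := by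
  simp only [bilinContraction_apply, toLp_eq_sum_smul_single, Matrix.vecMulVec_apply, map_sum,
    map_smul, sum_apply, smul_apply, smul_eq_mul, Finset.mul_sum, mul_assoc]
  rw [Finset.sum_comm]
  simp only [mul_left_comm]

theorem bilinContraction_smulRight (a : Matrix ι ι ℝ) (ℓ : EuclideanSpace ℝ ι →L[ℝ] ℝ) :
    bilinContraction a (ℓ.smulRight ℓ) = (fun i => ℓ (EuclideanSpace.single i 1)) ⬝ᵥ
      a.mulVec fun i => ℓ (EuclideanSpace.single i 1) := by
  simp only [bilinContraction_apply, ContinuousLinearMap.smulRight_apply, smul_apply, smul_eq_mul,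
    dotProduct, Matrix.mulVec, Finset.mul_sum]
  exact Finset.sum_congr rfl fun i _ => Finset.sum_congr rfl fun j _ => by ring

theorem isElliptic_bilinContraction {a : Matrix ι ι ℝ} (ha : a.PosDef) :
    IsElliptic (bilinContraction a) where
  nonpos {H} hH := by
    obtain ⟨m, v, rfl⟩ := Matrix.posSemidef_iff_eq_sum_vecMulVec.1 ha.posSemidef
    simp only [map_sum, sum_apply, star_trivial, bilinContraction_vecMulVec]
    exact Finset.sum_nonpos fun k _ => hH _
  smulRight_pos {ℓ} hℓ := by
    have hne : (fun i => ℓ (EuclideanSpace.single i 1)) ≠ 0 := fun hzero => hℓ <| by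
      ext w
      rw [← WithLp.toLp_ofLp 2 w, toLp_eq_sum_smul_single]
      simp [congrFun hzero]
    rw [bilinContraction_smulRight]
    simpa using ha.dotProduct_mulVec_pos hne

end Contraction

variable {n : ℕ} {G : LeafModel n → Matrix (Fin n) (Fin n) ℝ} {u : LeafModel n → ℝ}
  {x : LeafModel n}

theorem leafPartial_leafPartial (hu : ContDiffAt ℝ 2 u x) (i j : Fin n) :
    leafPartial i (leafPartial j u) x =
      fderiv ℝ (fderiv ℝ u) x (EuclideanSpace.single i 1) (EuclideanSpace.single j 1) := by
  have hfderiv := (differentiableAt_fderiv_of_contDiffAt hu).hasFDerivAt.clm_apply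
    (hasFDerivAt_const (EuclideanSpace.single j (1 : ℝ)) x)
  rw [leafPartial, show leafPartial j u = fun y => fderiv ℝ u y _ from rfl, hfderiv.fderiv]
  simp

/-- The first-order coefficient `bᵏ = -gⁱʲ Γᵏᵢⱼ` of the Laplace–Beltrami operator of `G`. -/
def laplaceBeltramiDrift (G : LeafModel n → Matrix (Fin n) (Fin n) ℝ) (x : LeafModel n) :
    LeafModel n :=
  WithLp.toLp 2 fun k => -∑ i, ∑ j, (G x)⁻¹ i j * christoffelSymbol G x k i j

theorem laplaceBeltrami_eq_secondOrderOp (hu : ContDiffAt ℝ 2 u x) :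
    laplaceBeltrami G u x =
      secondOrderOp (fun y => bilinContraction (G y)⁻¹) (laplaceBeltramiDrift G) u x := by
  have hdrift : fderiv ℝ u x (laplaceBeltramiDrift G x) =
      -∑ i, ∑ j, (G x)⁻¹ i j * ∑ k, christoffelSymbol G x k i j * leafPartial k u x := by
    simp only [laplaceBeltramiDrift, toLp_eq_sum_smul_single, map_sum, map_smul, smul_eq_mul,
      neg_mul, Finset.sum_neg_distrib, Finset.sum_mul, Finset.mul_sum, mul_assoc, leafPartial]
    rw [Finset.sum_comm]
    simp_rw [Finset.sum_comm (s := Finset.univ (α := Fin n)) (f := fun _ j => (G x)⁻¹ _ j * _)]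
  rw [secondOrderOp, hdrift, bilinContraction_apply, ← sub_eq_add_neg, ← Finset.sum_sub_distrib]
  simp only [laplaceBeltrami, leafPartial_leafPartial hu, mul_sub, Finset.sum_sub_distrib]

theorem continuousAt_inv_of_contDiffAt (hG : (G x).PosDef)
    (hG' : ∀ i j, ContDiffAt ℝ 1 (fun y => G y i j) x) : ContinuousAt (fun y => (G y)⁻¹) x := by
  have hinverse : ContinuousAt Ring.inverse (G x).det := by
    rw [Ring.inverse_eq_inv']
    exact continuousAt_inv₀ hG.det_pos.ne'
  exact (continuousAt_matrix_inv _ hinverse).comp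
    (continuousAt_pi.2 fun i => continuousAt_pi.2 fun j => (hG' i j).continuousAt)

theorem continuousAt_christoffelSymbol (hG : (G x).PosDef)
    (hG' : ∀ i j, ContDiffAt ℝ 1 (fun y => G y i j) x) (k i j : Fin n) :
    ContinuousAt (fun y => christoffelSymbol G y k i j) x := by
  have hinv := continuousAt_inv_of_contDiffAt hG hG'
  have hpartial (l i j : Fin n) : ContinuousAt (leafPartial l fun y => G y i j) x :=
    ((hG' i j).fderiv_right (m := 0) le_rfl).continuousAt.clm_apply continuousAt_const
  refine continuousAt_const.mul (tendsto_finsetSum _ fun l _ => ?_)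
  exact (continuousAt_pi.1 (continuousAt_pi.1 hinv k) l).mul
    (((hpartial i j l).add (hpartial j i l)).sub (hpartial l i j))

theorem continuousAt_laplaceBeltramiDrift (hG : (G x).PosDef)
    (hG' : ∀ i j, ContDiffAt ℝ 1 (fun y => G y i j) x) :
    ContinuousAt (laplaceBeltramiDrift G) x := by
  have hinv := continuousAt_inv_of_contDiffAt hG hG'
  refine (PiLp.continuous_toLp 2 _).continuousAt.comp (continuousAt_pi.2 fun k => ?_)
  refine (tendsto_finsetSum _ fun i _ => tendsto_finsetSum _ fun j _ => ?_).neg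
  exact (continuousAt_pi.1 (continuousAt_pi.1 hinv i) j).mul
    (continuousAt_christoffelSymbol hG hG' k i j)

theorem eventually_eq_of_isLocalMax_of_laplaceBeltrami_nonneg
    (hG : ∀ᶠ y in 𝓝 x, (G y).PosDef) (hG' : ∀ i j, ContDiffAt ℝ 1 (fun y => G y i j) x)
    (hu : ContDiffAt ℝ 2 u x) (hLu : ∀ᶠ y in 𝓝 x, 0 ≤ laplaceBeltrami G u y)
    (hmax : IsLocalMax u x) : ∀ᶠ y in 𝓝 x, u y = u x := by
  have hG'' : ∀ᶠ y in 𝓝 x, ∀ i j, ContDiffAt ℝ 1 (fun y => G y i j) y :=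
    Filter.eventually_all.2 fun i => Filter.eventually_all.2 fun j =>
      (hG' i j).eventually (by simp)
  have hcontraction : Continuous (bilinContraction (ι := Fin n)) :=
    LinearMap.continuous_of_finiteDimensional _
  refine eventually_eq_of_isLocalMax (A := fun y => bilinContraction (G y)⁻¹)
    (b := laplaceBeltramiDrift G) (hG.mono fun y hy => isElliptic_bilinContraction hy.inv)
    ?_ ?_ hu ?_ hmax
  · filter_upwards [hG, hG''] with y hy hy'
    exact hcontraction.continuousAt.comp (continuousAt_inv_of_contDiffAt hy hy')
  · filter_upwards [hG, hG''] with y hy hy' using continuousAt_laplaceBeltramiDrift hy hy'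
  · filter_upwards [hLu, hu.eventually (by simp)] with y hy huy
    rwa [← laplaceBeltrami_eq_secondOrderOp huy]

theorem leafPartial_neg (i : Fin n) (u : LeafModel n → ℝ) :
    leafPartial i (fun y => -u y) = fun y => -leafPartial i u y := by
  funext y
  simp [leafPartial, fderiv_fun_neg]

theorem laplaceBeltrami_neg (G : LeafModel n → Matrix (Fin n) (Fin n) ℝ) (u : LeafModel n → ℝ)
    (x : LeafModel n) : laplaceBeltrami G (fun y => -u y) x = -laplaceBeltrami G u x := by
  simp only [laplaceBeltrami, leafPartial_neg, mul_neg, ← Finset.sum_neg_distrib]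
  refine Finset.sum_congr rfl fun i _ => Finset.sum_congr rfl fun j _ => ?_
  rw [Finset.sum_neg_distrib]
  ring

end LaplaceBeltrami

end

namespace LeafwiseMetric

variable {n : ℕ} {M : Type u} [TopologicalSpace M] {F : CodimOneFoliation n M}
  {g : LeafwiseMetric F} {f : M → ℝ}

theorem IsLeafwiseHarmonic.neg (hf : g.IsLeafwiseHarmonic f) :
    g.IsLeafwiseHarmonic fun x => -f x := by
  refine ⟨hf.1.neg, fun φ hφ q hq => ⟨(hf.2 φ hφ q hq).1.neg, ?_⟩⟩
  rw [laplaceBeltrami_neg, (hf.2 φ hφ q hq).2, neg_zero]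

theorem IsLeafwiseHarmonic.eventually_eq_of_forall_le (hf : g.IsLeafwiseHarmonic f) {x : M}
    (hx : ∀ y, f y ≤ f x) : ∀ᶠ y in F.leafNhds x, f y = f x := by
  obtain ⟨φ, hφ, hxφ⟩ := F.covers x
  have hplaque : ∀ᶠ v in 𝓝 (φ x).1, (v, (φ x).2) ∈ φ.target :=
    (φ.open_target.preimage (by fun_prop : Continuous fun v : LeafModel n => (v, (φ x).2))).mem_nhds
      (φ.map_source hxφ)
  have hxval : f (φ.symm ((φ x).1, (φ x).2)) = f x := by rw [Prod.mk.eta, φ.left_inv hxφ]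
  rw [F.leafNhds_eq_map hφ hxφ, Filter.eventually_map, ← hxval]
  exact eventually_eq_of_isLocalMax_of_laplaceBeltrami_nonneg
    (G := fun v => g.coeff φ (v, (φ x).2)) (u := fun v => f (φ.symm (v, (φ x).2)))
    (hplaque.mono fun v hv => g.posDef φ hφ _ hv)
    (fun i j => (g.regular φ hφ i j).1 _ (φ.map_source hxφ))
    (hf.2 φ hφ _ (φ.map_source hxφ)).1 (hplaque.mono fun v hv => (hf.2 φ hφ _ hv).2.ge)
    (Filter.Eventually.of_forall fun v => (hx _).trans_eq hxval.symm)

theorem IsLeafwiseHarmonic.isSaturated_setOf_eq (hf : g.IsLeafwiseHarmonic f) {m : ℝ}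
    (hm : ∀ x, f x ≤ m) : F.IsSaturated {x | f x = m} := by
  refine F.isSaturated_of_eventually_mem (isClosed_eq hf.1 continuous_const) ?_
  rintro x rfl
  exact hf.eventually_eq_of_forall_le hm

end LeafwiseMetric

theorem mainTheorem7_general {n : ℕ} {M : Type u} [TopologicalSpace M] [CompactSpace M]
    [ConnectedSpace M] (F : CodimOneFoliation n M) (g : LeafwiseMetric F)
    (hR : F.IsRCovered) (hc : ∀ x : M, ¬ F.IsCompactLeaf x) {f : M → ℝ}
    (hf : g.IsLeafwiseHarmonic f) : ∃ c : ℝ, ∀ x : M, f x = c := by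
  obtain ⟨xmax, -, hmax⟩ := isCompact_univ.exists_isMaxOn Set.univ_nonempty hf.1.continuousOn
  obtain ⟨xmin, -, hmin⟩ := isCompact_univ.exists_isMinOn Set.univ_nonempty hf.1.continuousOn
  replace hmax : ∀ x, f x ≤ f xmax := fun x => hmax (Set.mem_univ x)
  replace hmin : ∀ x, f xmin ≤ f x := fun x => hmin (Set.mem_univ x)
  rcases eq_or_ne (f xmin) (f xmax) with heq | hne
  · exact ⟨f xmax, fun x => (hmax x).antisymm (heq ▸ hmin x)⟩
  have hminSat : F.IsSaturated {x | f x = f xmin} := by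
    simpa only [neg_inj] using hf.neg.isSaturated_setOf_eq fun x => neg_le_neg (hmin x)
  obtain ⟨x, hx⟩ := hR.exists_isCompactLeaf hminSat (hf.isSaturated_setOf_eq hmax)
    (isClosed_eq hf.1 continuous_const) (isClosed_eq hf.1 continuous_const) ⟨xmin, rfl⟩ ⟨xmax, rfl⟩
    (Set.disjoint_left.2 fun x hxmin hxmax => hne (hxmin.symm.trans hxmax))
  exact absurd hx (hc x)

theorem mainTheorem7 {n : ℕ} {M : Type u} [TopologicalSpace M] [T2Space M] [CompactSpace M]
    [ConnectedSpace M] (F : CodimOneFoliation n M) (g : LeafwiseMetric F)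
    (hR : F.IsRCovered) (hc : ∀ x : M, ¬ F.IsCompactLeaf x) :
    (∀ f : M → ℝ, g.IsLeafwiseHarmonic f → ∃ c : ℝ, ∀ x : M, f x = c) ∧
      g.LiouvilleProperty := by
  refine ⟨fun f hf => mainTheorem7_general F g hR hc hf, fun f hf x y _ => ?_⟩
  obtain ⟨c, hfc⟩ := mainTheorem7_general F g hR hc hf
  rw [hfc, hfc]
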